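/- Let $\Omega\subset\mathbb R^d$ be open with Lebesgue measure $\lambda$, let $\mathcal P\subset\mathbb R^k$ be a set of parameters, $\mathcal P_n\subset\mathcal P$ a finite set of nodes, and let $\ell_\eta$, $\eta\in\mathcal P_n$, be Lagrange basis polynomials for these nodes, i.e. polynomials on $\mathbb R^k$ with $\ell_\eta(\nu)=\delta_{\eta\nu}$ for $\eta,\nu\in\mathcal P_n$. Let $\mathbb P^n=\operatorname{span}\{\ell_\eta:\eta\in\mathcal P_n\}$ and let $$\Lambda_n=\sup_{\mu\in\mathcal P}\sum_{\eta\in\mathcal P_n}|\ell_\eta(\mu)|\in[0,\infty]$$ be the Lebesgue constant. Let $u(\cdot,\mu)\in BV(\Omega)$ for every $\mu\in\mathcal P$, where $\|f\|_{BV(\Omega)}=\|f\|_{L_1(\Omega)}+|Df|(\Omega)$ and $|Df|(\Omega)$ is the total variation. Let $\phi(\mu,\eta):\Omega\to\Omega$, $\mu,\eta\in\mathcal P$, be transforms with $\phi(\mu,\mu)(x)=x$, let $v_\mu(x,\eta)=u(\phi(\mu,\eta)(x),\eta)$ be the transformed snapshots, let $\phi_m(\mu,\eta):\Omega\to\Omega$,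 $\mu\in\mathcal P$, $\eta\in\mathcal P_n$, be further (approximate) transforms, and put $$u_{n,m}(x,\mu)=\sum_{\eta\in\mathcal P_n}\ell_\eta(\mu)\,u(\phi_m(\mu,\eta)(x),\eta).$$ Assume that there are constants $c,C\ge 0$ and, for all $\mu\in\mathcal P$, $\eta\in\mathcal P_n$, maps $\Phi^s(\mu,\eta):\Omega\to\Omega$, $0\le s\le 1$, measurable in $x$ and differentiable in $s$ (one-sidedly at $s=0,1$), such that $\Phi^0(\mu,\eta)=\phi(\mu,\eta)$, $\Phi^1(\mu,\eta)=\phi_m(\mu,\eta)$, $$\Phi^s(\mu,\eta)_*\lambda(A)\le c\,\lambda(A)\quad\text{for all measurable }A\subset\Omega,\ 0\le s\le1,$$ $$\sup_{0\le s\le1,\ x\in\Omega}|\partial_s\Phi^s(\mu,\eta)(x)|\le C\,\|\phi(\mu,\eta)-\phi_m(\mu,\eta)\|_{L_\infty(\Omega)}.$$ Then for every $\mu\in\mathcal P$ $$\begin{aligned}\|u(\cdot,\mu)-u_{n,m}(\cdot,\mu)\|_{L_1(\Omega)}\le{}&(1+\Lambda_n)\int_\Omega\ \inf_{p\in\mathbb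 P^n}\ \sup_{\eta\in\mathcal P}|v_\mu(x,\eta)-p(\eta)|\,dx\\&+c\,C\,\Lambda_n\max_{\eta\in\mathcal P_n}\|u(\cdot,\eta)\|_{BV(\Omega)}\max_{\eta\in\mathcal P_n}\|\phi(\mu,\eta)-\phi_m(\mu,\eta)\|_{L_\infty(\Omega)}.\end{aligned}$$ Here the right-hand side is read in $[0,\infty]$ with $0\cdot\infty=0$, and the integral is a lower integral if its integrand is not measurable. -/

import Mathlib

open MeasureTheory Set
open scoped ENNReal NNReal

noncomputable section

namespace TransformedSnapshot

/-- The space `ℝ^d` of physical variables, with its Euclidean norm. -/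
abbrev Space (d : ℕ) : Type := EuclideanSpace ℝ (Fin d)

/-- The space `ℝ^k` of parameters. -/
abbrev Param (k : ℕ) : Type := Fin k → ℝ

/-! ### Functions of bounded variation on an open set -/

/-- The divergence of a vector field. -/
def divergence {d : ℕ} (ψ : Space d → Space d) (x : Space d) : ℝ :=
  ∑ i : Fin d, fderiv ℝ ψ x (EuclideanSpace.single i (1 : ℝ)) i

/-- Test fields for the total variation: `C¹` vector fields with compact support in `Ω` that are
bounded by one in the Euclidean norm. -/
structure IsTestField {d : ℕ} (Ω : Set (Space d)) (ψ : Space d → Space d) : Prop where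
  contDiff : ContDiff ℝ 1 ψ
  hasCompactSupport : HasCompactSupport ψ
  tsupport_subset : tsupport ψ ⊆ Ω
  norm_le_one : ∀ x, ‖ψ x‖ ≤ 1

/-- The total variation `|Df|(Ω) = sup {∫_Ω f div ψ}` over all test fields `ψ`. -/
def totalVariation {d : ℕ} (Ω : Set (Space d)) (f : Space d → ℝ) : ℝ≥0∞ :=
  ⨆ (ψ : Space d → Space d) (_ : IsTestField Ω ψ),
    ENNReal.ofReal (∫ x in Ω, f x * divergence ψ x)

/-- `f ∈ BV(Ω)`: `f` is integrable on `Ω` and has finite total variation there. -/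
structure IsBV {d : ℕ} (Ω : Set (Space d)) (f : Space d → ℝ) : Prop where
  integrableOn : IntegrableOn f Ω
  totalVariation_ne_top : totalVariation Ω f ≠ ∞

/-- `‖f‖_{BV(Ω)} = ‖f‖_{L₁(Ω)} + |Df|(Ω)`. -/
def bvNorm {d : ℕ} (Ω : Set (Space d)) (f : Space d → ℝ) : ℝ≥0∞ :=
  eLpNorm f 1 (volume.restrict Ω) + totalVariation Ω f

/-! ### Polynomial interpolation in the parameter -/

/-- `ℓ η`, `η ∈ Pn`, are Lagrange basis polynomials for the nodes `Pn`. In several variables they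
are not determined by the nodes (the choice fixes the interpolation space). -/
def IsLagrangeBasis {k : ℕ} (Pn : Finset (Param k))
    (ℓ : Param k → MvPolynomial (Fin k) ℝ) : Prop :=
  ∀ η ∈ Pn, ∀ ν ∈ Pn, MvPolynomial.eval ν (ℓ η) = if ν = η then 1 else 0

/-- The interpolation space: the span of the Lagrange basis polynomials. -/
def polySpace {k : ℕ} (Pn : Finset (Param k)) (ℓ : Param k → MvPolynomial (Fin k) ℝ) :
    Submodule ℝ (MvPolynomial (Fin k) ℝ) :=
  Submodule.span ℝ (ℓ '' (Pn : Set (Param k)))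

/-- The Lebesgue constant `sup_{μ ∈ P} ∑_{η ∈ Pn} |ℓ_η(μ)|`. -/
def lebesgueConst {k : ℕ} (P : Set (Param k)) (Pn : Finset (Param k))
    (ℓ : Param k → MvPolynomial (Fin k) ℝ) : ℝ≥0∞ :=
  ⨆ μ ∈ P, ∑ η ∈ Pn, ‖MvPolynomial.eval μ (ℓ η)‖ₑ

/-- The error of best approximation of `f` in the sup-norm on `P` by elements of the
interpolation space. -/
def bestApproxError {k : ℕ} (P : Set (Param k)) (Pn : Finset (Param k))
    (ℓ : Param k → MvPolynomial (Fin k) ℝ) (f : Param k → ℝ) : ℝ≥0∞ :=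
  ⨅ p ∈ polySpace Pn ℓ, ⨆ η ∈ P, ‖f η - MvPolynomial.eval η p‖ₑ

/-! ### Transformed snapshots -/

/-- The transformed snapshot `v_μ(x, η) = u(φ(μ, η)(x), η)`. -/
def transformedSnapshot {d k : ℕ} (u : Space d → Param k → ℝ)
    (φ : Param k → Param k → Space d → Space d) (μ : Param k) (x : Space d) (η : Param k) : ℝ :=
  u (φ μ η x) η

/-- The transformed snapshot interpolation `∑_{η ∈ Pn} ℓ_η(μ) u(φ(μ, η)(x), η)`. -/
def transformedInterpolation {d k : ℕ} (Pn : Finset (Param k))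
    (ℓ : Param k → MvPolynomial (Fin k) ℝ) (u : Space d → Param k → ℝ)
    (φ : Param k → Param k → Space d → Space d) (x : Space d) (μ : Param k) : ℝ :=
  ∑ η ∈ Pn, MvPolynomial.eval μ (ℓ η) * transformedSnapshot u φ μ x η

/-- A family `Φ s`, `0 ≤ s ≤ 1`, of measurable maps `Ω → Ω` that joins `φ` to `ψ` on `Ω` along
differentiable curves `s ↦ Φ s x`, with push-forwards `(Φ s)_* λ ≤ c λ` (`λ` the Lebesgue measure
on `Ω`) and with speed at most `C ‖φ - ψ‖_{L_∞(Ω)}`. -/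
structure IsTransformHomotopy {d : ℕ} (Ω : Set (Space d)) (c C : ℝ≥0)
    (φ ψ : Space d → Space d) (Φ : ℝ → Space d → Space d) : Prop where
  mapsTo : ∀ s ∈ Icc (0 : ℝ) 1, MapsTo (Φ s) Ω Ω
  zero : ∀ x ∈ Ω, Φ 0 x = φ x
  one : ∀ x ∈ Ω, Φ 1 x = ψ x
  aemeasurable : ∀ s ∈ Icc (0 : ℝ) 1, AEMeasurable (Φ s) (volume.restrict Ω)
  differentiable : ∀ x ∈ Ω, DifferentiableOn ℝ (fun s => Φ s x) (Icc 0 1)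
  map_le : ∀ s ∈ Icc (0 : ℝ) 1,
    (volume.restrict Ω).map (Φ s) ≤ (c : ℝ≥0∞) • volume.restrict Ω
  speed_le : ∀ s ∈ Icc (0 : ℝ) 1, ∀ x ∈ Ω,
    ‖derivWithin (fun t => Φ t x) (Icc 0 1) s‖ₑ
      ≤ (C : ℝ≥0∞) * eLpNorm (fun y => φ y - ψ y) ∞ (volume.restrict Ω)

end TransformedSnapshot

end

/-!
The error is split as `u - u_{n,m} = (u - ∑ ℓ_η v_μ(·, η)) + ∑ ℓ_η (u(φ, η) - u(φ_m, η))`.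

For fixed `x`, the first part is the error at `μ` of the interpolation of `v_μ(x, ·)`, because
`φ(μ, μ)` is the identity. Interpolation reproduces the space spanned by the Lagrange basis, so this
error is at most `1 + ∑ |ℓ_η(μ)|` times the error of best approximation
(`enorm_sub_interpolation_le`).

The second part is bounded by `IsTransformHomotopy.lintegral_enorm_sub_le`: a function `f` of bounded
variation satisfies `‖f ∘ Φ⁰ - f ∘ Φ¹‖_{L₁} ≤ c L |Df|(Ω)` if the curves `s ↦ Φˢ(x)` have speed at
most `L`. For a smooth `g` one integrates `|∇g|` along the curves and uses that the push-forwards of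
the Lebesgue measure are at most `c` times this measure. For general `f` let `f_j` be mollifications
of `f`, extended by zero outside `Ω`, with radii `r_j → 0`.

* On the set `U_j` of points at distance more than `r_j` from the complement of `Ω` one has
  `∫_{U_j} |∇f_j| ≤ |Df|(Ω)` (`lintegral_enorm_fderiv_mollify_le`), since a mollified test field on
  `U_j` is a test field on `Ω`. No smooth approximation up to the boundary is needed: for each `x`
  the curve `s ↦ Φˢ(x)` is compact in `Ω` and therefore lies in `U_j` for large `j`.
* `f_j → f` almost everywhere, hence also `f_j ∘ Φˢ → f ∘ Φˢ` almost everywhere, as `Φˢ` pulls null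
  sets back to null sets. Fatou's lemma then gives the estimate for `f`.

The integrals over `s` are replaced by Riemann sums, to which Fatou's lemma is applied as well, so
that no joint measurability of `(s, x) ↦ Φˢ(x)` is used.
-/

namespace TransformedSnapshot

open Filter Topology Convolution Pointwise

variable {d : ℕ}

/-! ### Mollification and the total variation -/

lemma continuous_divergence {w : Space d → Space d} (hw : ContDiff ℝ 1 w) :
    Continuous (divergence w) := by
  have h : Continuous (fderiv ℝ w) := hw.continuous_fderiv one_ne_zero
  unfold divergence
  refine continuous_finsetSum _ fun i _ => ?_
  exact (EuclideanSpace.proj (𝕜 := ℝ) i).continuous.comp (h.clm_apply continuous_const)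

lemma hasCompactSupport_divergence {w : Space d → Space d} (hw : HasCompactSupport w) :
    HasCompactSupport (divergence w) := by
  refine (hw.fderiv (𝕜 := ℝ)).mono fun x hx => ?_
  contrapose! hx
  simp [divergence, Function.notMem_support.mp hx]

/-- The divergence theorem for a compactly supported field, in its weak form. -/
lemma integral_fderiv_apply_eq_neg_integral_mul_divergence {g : Space d → ℝ}
    (hg : ContDiff ℝ 1 g) {w : Space d → Space d} (hw : ContDiff ℝ 1 w)
    (hwc : HasCompactSupport w) :
    ∫ x, fderiv ℝ g x (w x) = -∫ x, g x * divergence w x := by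
  have hDg : Continuous (fderiv ℝ g) := hg.continuous_fderiv one_ne_zero
  have hDw : Continuous (fderiv ℝ w) := hw.continuous_fderiv one_ne_zero
  have hwi (i : Fin d) : ContDiff ℝ 1 (fun x => w x i) :=
    (EuclideanSpace.proj (𝕜 := ℝ) i).contDiff.comp hw
  have hwic (i : Fin d) : HasCompactSupport (fun x => w x i) :=
    hwc.comp_left (g := fun v : Space d => v i) rfl
  have hfd (i : Fin d) (x v : Space d) : fderiv ℝ (fun x => w x i) x v = fderiv ℝ w x v i := by
    have := ((EuclideanSpace.proj (𝕜 := ℝ) i).hasFDerivAt.comp x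
      (hw.differentiable one_ne_zero x).hasFDerivAt).fderiv
    have h2 := congrArg (fun T => T v) this
    simpa [Function.comp_def] using h2
  have hcoord (x : Space d) : fderiv ℝ g x (w x)
      = ∑ i, fderiv ℝ g x (EuclideanSpace.single i (1 : ℝ)) * w x i := by
    conv_lhs => rw [← (EuclideanSpace.basisFun (Fin d) ℝ).sum_repr (w x)]
    simp [mul_comm]
  have hint1 (i : Fin d) : Integrable
      (fun x => fderiv ℝ g x (EuclideanSpace.single i (1 : ℝ)) * w x i) :=
    ((hDg.clm_apply continuous_const).mul (hwi i).continuous).integrable_of_hasCompactSupport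
      (hwic i).mul_left
  have hfc (i : Fin d) :
      Continuous (fun x => fderiv ℝ (fun x => w x i) x (EuclideanSpace.single i (1 : ℝ))) :=
    ((hwi i).continuous_fderiv one_ne_zero).clm_apply continuous_const
  have hint2 (i : Fin d) : Integrable
      (fun x => g x * fderiv ℝ (fun x => w x i) x (EuclideanSpace.single i (1 : ℝ))) :=
    (hg.continuous.mul (hfc i)).integrable_of_hasCompactSupport
      (((hwic i).fderiv_apply (𝕜 := ℝ) _).mul_left)
  have hint3 (i : Fin d) : Integrable (fun x => g x * w x i) :=
    (hg.continuous.mul (hwi i).continuous).integrable_of_hasCompactSupport (hwic i).mul_left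
  simp_rw [hcoord, divergence, Finset.mul_sum, ← hfd]
  rw [integral_finsetSum _ fun i _ => hint1 i, integral_finsetSum _ fun i _ => hint2 i,
    ← Finset.sum_neg_distrib]
  refine Finset.sum_congr rfl fun i _ => ?_
  rw [integral_mul_fderiv_eq_neg_fderiv_mul_of_integrable (hint1 i) (hint2 i) (hint3 i)
    (fun x _ => hg.differentiable one_ne_zero x)
    (fun x _ => (hwi i).differentiable one_ne_zero x), neg_neg]

/-- Mollification with an even kernel is symmetric. -/
lemma integral_mollify_mul (ρ : ContDiffBump (0 : Space d)) {f h : Space d → ℝ}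
    (hf : Integrable f) (hh : Continuous h) (hhc : HasCompactSupport h) :
    ∫ x, (ρ.normed volume ⋆[ContinuousLinearMap.lsmul ℝ ℝ] f) x * h x
      = ∫ x, f x * (ρ.normed volume ⋆[ContinuousLinearMap.lsmul ℝ ℝ] h) x := by
  have hint : Integrable (fun p : Space d × Space d =>
      (f p.2 * ρ.normed volume (p.1 - p.2)) * h p.1) (volume.prod volume) := by
    have h1 := hf.convolution_integrand (ContinuousLinearMap.lsmul ℝ ℝ)
      (ρ.integrable_normed (μ := volume))
    obtain ⟨B, hB⟩ := hhc.exists_bound_of_continuous hh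
    refine h1.mul_bdd (c := B) (hh.comp continuous_fst).aestronglyMeasurable ?_
    exact Eventually.of_forall fun p => hB p.1
  have h1 (x : Space d) : (ρ.normed volume ⋆[ContinuousLinearMap.lsmul ℝ ℝ] f) x * h x
      = ∫ t, (f t * ρ.normed volume (x - t)) * h x := by
    rw [convolution_lsmul_swap, integral_mul_const]
    simp [mul_comm]
  have h2 (t : Space d) : f t * (ρ.normed volume ⋆[ContinuousLinearMap.lsmul ℝ ℝ] h) t
      = ∫ x, (f t * ρ.normed volume (x - t)) * h x := by
    rw [convolution_lsmul_swap, ← integral_const_mul]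
    congr 1 with x
    rw [← neg_sub x t, ρ.normed_neg, smul_eq_mul, mul_assoc]
  simp_rw [h1, h2]
  exact integral_integral_swap hint

lemma divergence_mollify (ρ : ContDiffBump (0 : Space d)) {w : Space d → Space d}
    (hw : ContDiff ℝ 1 w) (hwc : HasCompactSupport w) (x : Space d) :
    divergence (ρ.normed volume ⋆[ContinuousLinearMap.lsmul ℝ ℝ] w) x
      = (ρ.normed volume ⋆[ContinuousLinearMap.lsmul ℝ ℝ] divergence w) x := by
  have hρ : LocallyIntegrable (ρ.normed volume) (volume : Measure (Space d)) :=
    ρ.continuous_normed.locallyIntegrable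
  have hDw : Continuous (fderiv ℝ w) := hw.continuous_fderiv one_ne_zero
  have h1 := (hwc.hasFDerivAt_convolution_right (ContinuousLinearMap.lsmul ℝ ℝ) hρ hw x).fderiv
  unfold divergence
  simp_rw [h1]
  have hex (i : Fin d) : ConvolutionExistsAt (ρ.normed volume)
      (fun y => fderiv ℝ w y (EuclideanSpace.single i (1 : ℝ))) x
      (ContinuousLinearMap.lsmul ℝ ℝ) volume :=
    (hwc.fderiv_apply (𝕜 := ℝ) _).convolutionExists_right _ hρ
      (hDw.clm_apply continuous_const) x
  have hexi (i : Fin d) : Integrable (fun t => ρ.normed volume t •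
      fderiv ℝ w (x - t) (EuclideanSpace.single i (1 : ℝ)) i) := by
    have := (EuclideanSpace.proj (𝕜 := ℝ) i).integrable_comp (hex i)
    simpa using this
  have hR : (ρ.normed volume ⋆[ContinuousLinearMap.lsmul ℝ ℝ] (fun y : Space d =>
      ∑ i, fderiv ℝ w y (EuclideanSpace.single i (1 : ℝ)) i)) x
      = ∑ i, ∫ t, ρ.normed volume t • fderiv ℝ w (x - t) (EuclideanSpace.single i (1 : ℝ)) i := by
    rw [convolution_lsmul, ← integral_finsetSum _ fun i _ => hexi i]
    simp_rw [Finset.smul_sum]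
  rw [hR]
  refine Finset.sum_congr rfl fun i _ => ?_
  rw [convolution_precompR_apply _ hρ (hwc.fderiv (𝕜 := ℝ)) hDw, convolution_lsmul]
  have := (EuclideanSpace.proj (𝕜 := ℝ) i).integral_comp_comm (hex i)
  simpa using this.symm

/-- Mollification with radius at most `r` turns test fields on the set of points at distance more
than `r` from the complement of `Ω` into test fields on `Ω`. -/
lemma IsTestField.mollify {Ω : Set (Space d)} (ρ : ContDiffBump (0 : Space d)) {r : ℝ}
    (hr : ρ.rOut ≤ r) {w : Space d → Space d}
    (hw : IsTestField {x | ENNReal.ofReal r < Metric.infEDist x Ωᶜ} w) :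
    IsTestField Ω (ρ.normed volume ⋆[ContinuousLinearMap.lsmul ℝ ℝ] w) := by
  have hρ : LocallyIntegrable (ρ.normed volume) (volume : Measure (Space d)) :=
    ρ.continuous_normed.locallyIntegrable
  refine ⟨hw.hasCompactSupport.contDiff_convolution_right _ hρ hw.contDiff,
    ρ.hasCompactSupport_normed.convolution _ hw.hasCompactSupport, ?_, fun x => ?_⟩
  · have hcpt : IsCompact (tsupport (ρ.normed (volume : Measure (Space d))) + tsupport w) :=
      ρ.hasCompactSupport_normed.isCompact.add hw.hasCompactSupport.isCompact
    have hsub : tsupport (ρ.normed volume ⋆[ContinuousLinearMap.lsmul ℝ ℝ] w)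
        ⊆ tsupport (ρ.normed (volume : Measure (Space d))) + tsupport w := by
      refine closure_minimal ?_ hcpt.isClosed
      exact (support_convolution_subset _).trans
        (Set.add_subset_add subset_closure subset_closure)
    intro x hx
    obtain ⟨a, ha, b, hb, rfl⟩ := hsub hx
    rw [ρ.tsupport_normed_eq, mem_closedBall_zero_iff] at ha
    have hb' : ENNReal.ofReal r < Metric.infEDist b Ωᶜ := hw.tsupport_subset hb
    by_contra hmem
    have h1 : Metric.infEDist b Ωᶜ ≤ edist b (a + b) := Metric.infEDist_le_edist_of_mem hmem
    have h2 : edist b (a + b) ≤ ENNReal.ofReal r := by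
      rw [edist_dist]
      refine ENNReal.ofReal_le_ofReal ?_
      rw [dist_eq_norm]
      simpa using ha.trans hr
    exact absurd (hb'.trans_le (h1.trans h2)) (lt_irrefl _)
  · rw [convolution_lsmul]
    calc ‖∫ t, ρ.normed volume t • w (x - t)‖
        ≤ ∫ t, ρ.normed volume t := by
          refine norm_integral_le_of_norm_le ρ.integrable_normed (Eventually.of_forall fun t => ?_)
          rw [norm_smul, Real.norm_of_nonneg (ρ.nonneg_normed t)]
          exact mul_le_of_le_one_right (ρ.nonneg_normed t) (hw.norm_le_one _)
      _ = 1 := ρ.integral_normed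

lemma IsTestField.neg {Ω : Set (Space d)} {w : Space d → Space d} (hw : IsTestField Ω w) :
    IsTestField Ω (fun x => -w x) where
  contDiff := hw.contDiff.neg
  hasCompactSupport := hw.hasCompactSupport.comp_left neg_zero
  tsupport_subset := by
    have : tsupport (fun x => -w x) = tsupport w := by simp [tsupport, Function.support]
    rw [this]; exact hw.tsupport_subset
  norm_le_one x := by simpa using hw.norm_le_one x

lemma ofReal_integral_mul_divergence_le {Ω : Set (Space d)} {f : Space d → ℝ}
    {w : Space d → Space d} (hw : IsTestField Ω w) :
    ENNReal.ofReal (∫ x in Ω, f x * divergence w x) ≤ totalVariation Ω f :=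
  le_iSup₂ (f := fun ψ (_ : IsTestField Ω ψ) =>
    ENNReal.ofReal (∫ x in Ω, f x * divergence ψ x)) w hw

/-- The mollification with kernel `ρ` of the extension of `f` by zero outside `Ω`. -/
noncomputable def mollify (Ω : Set (Space d)) (ρ : ContDiffBump (0 : Space d))
    (f : Space d → ℝ) : Space d → ℝ :=
  ρ.normed volume ⋆[ContinuousLinearMap.lsmul ℝ ℝ] Ω.indicator f

lemma contDiff_mollify {Ω : Set (Space d)} (hΩ : MeasurableSet Ω) {f : Space d → ℝ}
    (hf : IntegrableOn f Ω) (ρ : ContDiffBump (0 : Space d)) :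
    ContDiff ℝ 2 (mollify Ω ρ f) :=
  ρ.hasCompactSupport_normed.contDiff_convolution_left (n := 2) _ ρ.contDiff_normed
    (hf.integrable_indicator hΩ).locallyIntegrable

/-- The gradient of a mollification is tested against `w` by integrating by parts and moving the
mollifier onto the divergence of `w`. -/
lemma ofReal_integral_fderiv_mollify_le {Ω : Set (Space d)} (hΩ : MeasurableSet Ω)
    {f : Space d → ℝ} (hf : IntegrableOn f Ω) (ρ : ContDiffBump (0 : Space d)) {r : ℝ}
    (hr : ρ.rOut ≤ r) {w : Space d → Space d}
    (hw : IsTestField {x | ENNReal.ofReal r < Metric.infEDist x Ωᶜ} w) :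
    ENNReal.ofReal (∫ x, fderiv ℝ (mollify Ω ρ f) x (w x)) ≤ totalVariation Ω f := by
  have hfi := hf.integrable_indicator hΩ
  rw [integral_fderiv_apply_eq_neg_integral_mul_divergence
    ((contDiff_mollify hΩ hf ρ).of_le one_le_two) hw.contDiff hw.hasCompactSupport, mollify,
    integral_mollify_mul ρ hfi (continuous_divergence hw.contDiff)
      (hasCompactSupport_divergence hw.hasCompactSupport)]
  simp_rw [← divergence_mollify ρ hw.contDiff hw.hasCompactSupport]
  refine le_of_eq_of_le ?_ (ofReal_integral_mul_divergence_le (hw.mollify ρ hr).neg)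
  congr 1
  rw [← integral_neg, ← integral_indicator hΩ]
  congr 1 with x
  have : divergence (fun y => -(ρ.normed volume ⋆[ContinuousLinearMap.lsmul ℝ ℝ] w) y) x
      = -divergence (ρ.normed volume ⋆[ContinuousLinearMap.lsmul ℝ ℝ] w) x := by
    simp [divergence, fderiv_fun_neg]
  by_cases hx : x ∈ Ω <;> simp [hx, this]

/-! ### The total variation of a smooth function -/

/-- An exhausting sequence of smooth cutoff functions on an open set. -/
lemma exists_cutoff_sequence {U : Set (Space d)} (hU : IsOpen U) :
    ∃ χ : ℕ → Space d → ℝ, (∀ n, ContDiff ℝ 1 (χ n)) ∧ (∀ n, HasCompactSupport (χ n)) ∧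
      (∀ n, tsupport (χ n) ⊆ U) ∧ (∀ n x, χ n x ∈ Icc (0 : ℝ) 1) ∧
      ∀ x ∈ U, ∀ᶠ n in atTop, χ n x = 1 := by
  obtain ⟨F, hFc, hFU, hFeq, hFmono⟩ := hU.exists_iUnion_isClosed
  have hK (n : ℕ) : ∃ χ : Space d → ℝ, ContDiff ℝ 1 χ ∧ HasCompactSupport χ ∧
      tsupport χ ⊆ U ∧ (∀ x, χ x ∈ Icc (0 : ℝ) 1) ∧
      ∀ x ∈ F n ∩ Metric.closedBall 0 n, χ x = 1 := by
    have hcpt : IsCompact (F n ∩ Metric.closedBall (0 : Space d) n) :=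
      (isCompact_closedBall _ _).inter_left (hFc n)
    obtain ⟨t, ht, hst, htU⟩ := exists_compact_between hcpt hU (inter_subset_left.trans (hFU n))
    obtain ⟨f, hf1, hf0, hf⟩ := exists_contMDiffMap_one_nhds_of_subset_interior (n := 1)
      (modelWithCornersSelf ℝ (Space d)) hcpt.isClosed hst
    have hsupp : tsupport f ⊆ t := closure_minimal
      (fun x hx => by_contra fun hxt => hx (hf0 x hxt)) ht.isClosed
    exact ⟨f, f.contMDiff.contDiff, ht.of_isClosed_subset (isClosed_tsupport _) hsupp,
      hsupp.trans htU, hf, fun x hx => (hf1.filter_mono (nhds_le_nhdsSet hx)).self_of_nhds⟩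
  choose χ h1 h2 h3 h4 h5 using hK
  refine ⟨χ, h1, h2, h3, h4, fun x hx => ?_⟩
  rw [← hFeq] at hx
  obtain ⟨m, hm⟩ := mem_iUnion.mp hx
  obtain ⟨N, hN⟩ := exists_nat_ge ‖x‖
  filter_upwards [eventually_ge_atTop m, eventually_ge_atTop N] with n hn hn'
  refine h5 n x ⟨hFmono hn hm, ?_⟩
  rw [mem_closedBall_zero_iff]
  exact hN.trans (by exact_mod_cast hn')

lemma tendsto_sq_div_sqrt_sq_add (a : ℝ) (ha : 0 ≤ a) :
    Tendsto (fun n : ℕ => (√(a ^ 2 + 1 / ((n : ℝ) + 1)))⁻¹ * a ^ 2) atTop (𝓝 a) := by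
  rcases ha.eq_or_lt with rfl | ha'
  · simp
  have h0 : Tendsto (fun n : ℕ => a ^ 2 + 1 / ((n : ℝ) + 1)) atTop (𝓝 (a ^ 2 + 0)) :=
    tendsto_const_nhds.add tendsto_one_div_add_atTop_nhds_zero_nat
  have h1 := (h0.sqrt.inv₀ (by simp [ha, ha'.ne'])).mul_const (a ^ 2)
  rw [add_zero, Real.sqrt_sq ha] at h1
  convert! h1 using 2
  field_simp

/-- The total variation of a smooth function bounds the integral of its gradient: the gradient is
tested against the cut off and regularised fields `χ ∇g / √(|∇g|² + ε)`. -/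
lemma lintegral_enorm_fderiv_le {U : Set (Space d)} (hU : IsOpen U) {g : Space d → ℝ}
    (hg : ContDiff ℝ 2 g) {M : ℝ≥0∞}
    (h : ∀ w, IsTestField U w → ENNReal.ofReal (∫ x, fderiv ℝ g x (w x)) ≤ M) :
    ∫⁻ x in U, ‖fderiv ℝ g x‖ₑ ≤ M := by
  obtain ⟨χ, hχ, hχc, hχU, hχI, hχ1⟩ := exists_cutoff_sequence hU
  set G : Space d → Space d := fun x => (InnerProductSpace.toDual ℝ (Space d)).symm (fderiv ℝ g x)
    with hG
  have hGn (x : Space d) : ‖G x‖ = ‖fderiv ℝ g x‖ := LinearIsometryEquiv.norm_map _ _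
  have hGG (x : Space d) : fderiv ℝ g x (G x) = ‖G x‖ ^ 2 := by
    rw [← real_inner_self_eq_norm_sq, hG]
    exact (InnerProductSpace.toDual_symm_apply).symm
  have hGd : ContDiff ℝ 1 G :=
    (InnerProductSpace.toDual ℝ (Space d)).symm.contDiff.comp (hg.fderiv_right (by norm_num))
  set s : ℕ → Space d → ℝ := fun n x => √(‖G x‖ ^ 2 + 1 / ((n : ℝ) + 1)) with hs
  have hpos (n : ℕ) (x : Space d) : 0 < ‖G x‖ ^ 2 + 1 / ((n : ℝ) + 1) := by positivity
  have hspos (n : ℕ) (x : Space d) : 0 < s n x := Real.sqrt_pos.mpr (hpos n x)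
  have hsd (n : ℕ) : ContDiff ℝ 1 (s n) :=
    ((hGd.norm_sq ℝ).add contDiff_const).sqrt fun x => (hpos n x).ne'
  set w : ℕ → Space d → Space d := fun n x => (χ n x * (s n x)⁻¹) • G x with hw
  have hwsupp (n : ℕ) : Function.support (w n) ⊆ Function.support (χ n) := by
    intro x hx
    contrapose! hx
    simp [hw, Function.notMem_support.mp hx]
  have hwtest (n : ℕ) : IsTestField U (w n) := by
    refine ⟨((hχ n).mul ((hsd n).inv fun x => (hspos n x).ne')).smul hGd, (hχc n).mono (hwsupp n),
      (closure_mono (hwsupp n)).trans (hχU n), fun x => ?_⟩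
    have h1 : ‖G x‖ ≤ s n x := Real.le_sqrt_of_sq_le (by simp; positivity)
    rw [hw, norm_smul, norm_mul, norm_inv, Real.norm_of_nonneg (hχI n x).1,
      Real.norm_of_nonneg (hspos n x).le, mul_assoc]
    refine mul_le_one₀ (hχI n x).2 (by positivity) ?_
    rw [inv_mul_le_one₀ (hspos n x)]
    exact h1
  have hfw (n : ℕ) (x : Space d) :
      fderiv ℝ g x (w n x) = χ n x * ((s n x)⁻¹ * ‖G x‖ ^ 2) := by
    simp only [hw, map_smul, hGG, smul_eq_mul, mul_assoc]
  have hfw0 (n : ℕ) (x : Space d) : 0 ≤ fderiv ℝ g x (w n x) := by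
    rw [hfw]
    have := (hχI n x).1
    have := hspos n x
    positivity
  have hDg : Continuous (fderiv ℝ g) := hg.continuous_fderiv two_ne_zero
  have hcont (n : ℕ) : Continuous (fun x => fderiv ℝ g x (w n x)) :=
    hDg.clm_apply (hwtest n).contDiff.continuous
  have hbd (n : ℕ) : ∫⁻ x in U, ENNReal.ofReal (fderiv ℝ g x (w n x)) ≤ M := by
    refine (setLIntegral_le_lintegral _ _).trans ?_
    rw [← ofReal_integral_eq_lintegral_ofReal _ (Eventually.of_forall (hfw0 n))]
    · exact h _ (hwtest n)
    · refine (hcont n).integrable_of_hasCompactSupport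
        ((hwtest n).hasCompactSupport.mono fun x hx => ?_)
      contrapose! hx
      simp [Function.notMem_support.mp hx]
  calc ∫⁻ x in U, ‖fderiv ℝ g x‖ₑ
      ≤ ∫⁻ x in U, liminf (fun n => ENNReal.ofReal (fderiv ℝ g x (w n x))) atTop := by
        refine setLIntegral_mono' hU.measurableSet fun x hx => ?_
        have h1 : Tendsto (fun n => fderiv ℝ g x (w n x)) atTop (𝓝 ‖G x‖) := by
          refine (tendsto_sq_div_sqrt_sq_add ‖G x‖ (norm_nonneg _)).congr' ?_
          filter_upwards [hχ1 x hx] with n hn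
          rw [hfw, hn, one_mul]
        have h2 := (ENNReal.tendsto_ofReal h1).liminf_eq
        rw [h2, hGn, ofReal_norm]
    _ ≤ liminf (fun n => ∫⁻ x in U, ENNReal.ofReal (fderiv ℝ g x (w n x))) atTop :=
        lintegral_liminf_le fun n => (hcont n).measurable.ennreal_ofReal
    _ ≤ M := liminf_le_of_frequently_le' (Frequently.of_forall hbd)

/-- Mollification does not increase the total variation, away from the boundary. -/
lemma lintegral_enorm_fderiv_mollify_le {Ω : Set (Space d)} (hΩ : MeasurableSet Ω)
    {f : Space d → ℝ} (hf : IntegrableOn f Ω) (ρ : ContDiffBump (0 : Space d)) {r : ℝ}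
    (hr : ρ.rOut ≤ r) :
    ∫⁻ x in {x | ENNReal.ofReal r < Metric.infEDist x Ωᶜ}, ‖fderiv ℝ (mollify Ω ρ f) x‖ₑ
      ≤ totalVariation Ω f :=
  lintegral_enorm_fderiv_le (isOpen_lt continuous_const Metric.continuous_infEDist)
    (contDiff_mollify hΩ hf ρ) fun _ hw => ofReal_integral_fderiv_mollify_le hΩ hf ρ hr hw

/-! ### Change of a function along a curve -/

/-- A `C¹` function changes along a curve of speed at most `L` by at most `L` times the Riemann
sums of `|∇g|`, up to a small error. -/
lemma eventually_norm_sub_le_riemannSum {g : Space d → ℝ} (hg : ContDiff ℝ 1 g)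
    {γ : ℝ → Space d} (hγ : DifferentiableOn ℝ γ (Icc 0 1)) {L : ℝ}
    (hγL : ∀ s ∈ Icc (0 : ℝ) 1, ‖derivWithin γ (Icc 0 1) s‖ ≤ L) {ε : ℝ} (hε : 0 < ε) :
    ∀ᶠ N : ℕ in atTop, ‖g (γ 1) - g (γ 0)‖ ≤
      L * (((N : ℝ) + 1)⁻¹ * ∑ i ∈ Finset.range (N + 1), ‖fderiv ℝ g (γ (i / ((N : ℝ) + 1)))‖)
        + L * ε := by
  have hDg : Continuous (fderiv ℝ g) := hg.continuous_fderiv one_ne_zero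
  have huc : UniformContinuousOn (fun s => fderiv ℝ g (γ s)) (Icc 0 1) :=
    isCompact_Icc.uniformContinuousOn_of_continuous (hDg.comp_continuousOn hγ.continuousOn)
  obtain ⟨δ, hδ, hδε⟩ := Metric.uniformContinuousOn_iff.mp huc ε hε
  have hlim := (tendsto_one_div_add_atTop_nhds_zero_nat (𝕜 := ℝ)).eventually (gt_mem_nhds hδ)
  filter_upwards [hlim] with N hN
  have hN0 : (0 : ℝ) < (N : ℝ) + 1 := by positivity
  set t : ℕ → ℝ := fun i => i / ((N : ℝ) + 1) with ht
  have ht0 : t 0 = 0 := by simp [ht]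
  have ht1 : t (N + 1) = 1 := by simp only [ht]; push_cast; exact div_self hN0.ne'
  have htstep (i : ℕ) : t (i + 1) = t i + ((N : ℝ) + 1)⁻¹ := by
    simp only [ht]; push_cast; field_simp
  -- On each subinterval `∇g` is within `ε` of its value at the left end point.
  have hstep : ∀ i ∈ Finset.range (N + 1), ‖g (γ (t (i + 1))) - g (γ (t i))‖ ≤
      ((‖fderiv ℝ g (γ (t i))‖ + ε) * L) * ((N : ℝ) + 1)⁻¹ := by
    intro i hi
    have hi' : i + 1 ≤ N + 1 := Finset.mem_range.mp hi
    have hti0 : 0 ≤ t i := by simp only [ht]; positivity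
    have hti1 : t (i + 1) ≤ 1 := by
      rw [← ht1]; simp only [ht]; gcongr
    have hinv : 0 < ((N : ℝ) + 1)⁻¹ := by positivity
    have hle : t i ≤ t (i + 1) := by rw [htstep]; linarith
    have hsub : Icc (t i) (t (i + 1)) ⊆ Icc 0 1 := Icc_subset_Icc hti0 hti1
    have hmvt := (convex_Icc (t i) (t (i + 1))).norm_image_sub_le_of_norm_hasDerivWithin_le
      (f := fun s => g (γ s)) (f' := fun s => fderiv ℝ g (γ s) (derivWithin γ (Icc 0 1) s))
      (C := (‖fderiv ℝ g (γ (t i))‖ + ε) * L)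
      (fun s hs => ((hg.differentiable one_ne_zero (γ s)).hasFDerivAt.comp_hasDerivWithinAt s
        ((hγ s (hsub hs)).hasDerivWithinAt)).mono hsub)
      (fun s hs => ?_) (left_mem_Icc.mpr hle) (right_mem_Icc.mpr hle)
    · refine hmvt.trans_eq ?_
      rw [htstep, add_sub_cancel_left, Real.norm_of_nonneg hinv.le]
    · have hdist : dist s (t i) < δ := by
        rw [Real.dist_eq, abs_of_nonneg (by linarith [hs.1])]
        have := hs.2
        rw [htstep] at this
        rw [one_div] at hN
        linarith
      have h1 := hδε s (hsub hs) (t i) (hsub (left_mem_Icc.mpr hle)) hdist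
      rw [dist_eq_norm] at h1
      have h2 : ‖fderiv ℝ g (γ s)‖ ≤ ‖fderiv ℝ g (γ (t i))‖ + ε := by
        have := norm_le_norm_add_norm_sub' (fderiv ℝ g (γ s)) (fderiv ℝ g (γ (t i)))
        linarith
      exact ((fderiv ℝ g (γ s)).le_opNorm _).trans
        (mul_le_mul h2 (hγL s (hsub hs)) (norm_nonneg _) (by positivity))
  calc ‖g (γ 1) - g (γ 0)‖
      = ‖∑ i ∈ Finset.range (N + 1), (g (γ (t (i + 1))) - g (γ (t i)))‖ := by
        rw [Finset.sum_range_sub (fun i => g (γ (t i))), ht0, ht1]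
    _ ≤ ∑ i ∈ Finset.range (N + 1), ((‖fderiv ℝ g (γ (t i))‖ + ε) * L) * ((N : ℝ) + 1)⁻¹ :=
        norm_sum_le_of_le _ hstep
    _ = _ := by
        rw [← Finset.sum_mul, ← Finset.sum_mul, Finset.sum_add_distrib]
        simp only [Finset.sum_const, Finset.card_range, nsmul_eq_mul]
        push_cast
        field_simp
        ring

/-- The limit form of the Riemann sum bound, free of the error term and of the integrability
of `s ↦ ∂ₛγ`. -/
lemma enorm_sub_le_liminf_riemannSum {g : Space d → ℝ} (hg : ContDiff ℝ 1 g)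
    {γ : ℝ → Space d} (hγ : DifferentiableOn ℝ γ (Icc 0 1)) {L : ℝ≥0}
    (hγL : ∀ s ∈ Icc (0 : ℝ) 1, ‖derivWithin γ (Icc 0 1) s‖ₑ ≤ L) :
    ‖g (γ 1) - g (γ 0)‖ₑ ≤ liminf (fun N : ℕ => (L : ℝ≥0∞) * (((N : ℝ≥0∞) + 1)⁻¹ *
      ∑ i ∈ Finset.range (N + 1), ‖fderiv ℝ g (γ (i / ((N : ℝ) + 1)))‖ₑ)) atTop := by
  have hγL' : ∀ s ∈ Icc (0 : ℝ) 1, ‖derivWithin γ (Icc 0 1) s‖ ≤ (L : ℝ) := fun s hs => by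
    have := hγL s hs
    rw [enorm_eq_nnnorm] at this
    exact_mod_cast this
  have hlim : Tendsto (fun n : ℕ => ENNReal.ofReal
      (‖g (γ 1) - g (γ 0)‖ - L * (1 / ((n : ℝ) + 1)))) atTop (𝓝 ‖g (γ 1) - g (γ 0)‖ₑ) := by
    rw [← ofReal_norm]
    refine ENNReal.tendsto_ofReal ?_
    simpa using (tendsto_const_nhds (x := ‖g (γ 1) - g (γ 0)‖)).sub
      ((tendsto_one_div_add_atTop_nhds_zero_nat (𝕜 := ℝ)).const_mul (L : ℝ))
  refine le_of_tendsto' hlim fun n => le_liminf_of_le (by isBoundedDefault) ?_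
  filter_upwards [eventually_norm_sub_le_riemannSum hg hγ hγL'
    (ε := 1 / ((n : ℝ) + 1)) (by positivity)] with N hN
  have hR : ENNReal.ofReal ((L : ℝ) * (((N : ℝ) + 1)⁻¹ *
      ∑ i ∈ Finset.range (N + 1), ‖fderiv ℝ g (γ (i / ((N : ℝ) + 1)))‖))
      = (L : ℝ≥0∞) * (((N : ℝ≥0∞) + 1)⁻¹ *
      ∑ i ∈ Finset.range (N + 1), ‖fderiv ℝ g (γ (i / ((N : ℝ) + 1)))‖ₑ) := by
    rw [ENNReal.ofReal_mul L.coe_nonneg, ENNReal.ofReal_mul (by positivity),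
      ENNReal.ofReal_sum_of_nonneg fun i _ => norm_nonneg _, ENNReal.ofReal_inv_of_pos (by positivity),
      ENNReal.ofReal_add (by positivity) zero_le_one]
    simp
  rw [← hR]
  refine ENNReal.ofReal_le_ofReal ?_
  change _ ≤ (L : ℝ) * _ + (L : ℝ) * _ at hN
  linarith

/-! ### Functions of bounded variation along a transform homotopy -/

lemma aemeasurable_liminf {α : Type*} [MeasurableSpace α] {m : Measure α}
    {F : ℕ → α → ℝ≥0∞} (hF : ∀ n, AEMeasurable (F n) m) :
    AEMeasurable (fun x => liminf (fun n => F n x) atTop) m := by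
  refine ⟨fun x => liminf (fun n => (hF n).mk _ x) atTop,
    .liminf fun n => (hF n).measurable_mk, ?_⟩
  filter_upwards [ae_all_iff.mpr fun n => (hF n).ae_eq_mk] with x hx
  simp_rw [hx]

namespace IsTransformHomotopy

variable {Ω : Set (Space d)} {c C : ℝ≥0} {φ ψ : Space d → Space d} {Φ : ℝ → Space d → Space d}

/-- The maps `Φ s` pull null sets in `Ω` back to null sets. -/
lemma ae_comp (h : IsTransformHomotopy Ω c C φ ψ Φ) {s : ℝ}
    (hs : s ∈ Icc (0 : ℝ) 1) {p : Space d → Prop} (hp : ∀ᵐ x ∂volume.restrict Ω, p x) :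
    ∀ᵐ x ∂volume.restrict Ω, p (Φ s x) :=
  ae_of_ae_map (h.aemeasurable s hs)
    ((Measure.absolutelyContinuous_of_le_smul (h.map_le s hs)).ae_le hp)

lemma lintegral_comp_le (h : IsTransformHomotopy Ω c C φ ψ Φ) {s : ℝ}
    (hs : s ∈ Icc (0 : ℝ) 1) {H : Space d → ℝ≥0∞} (hH : Measurable H) :
    ∫⁻ x in Ω, H (Φ s x) ≤ c * ∫⁻ x in Ω, H x := by
  rw [← lintegral_map' hH.aemeasurable (h.aemeasurable s hs)]
  refine (lintegral_mono' (h.map_le s hs) le_rfl).trans_eq ?_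
  rw [lintegral_smul_measure]
  rfl

lemma aestronglyMeasurable_comp (h : IsTransformHomotopy Ω c C φ ψ Φ) {s : ℝ}
    (hs : s ∈ Icc (0 : ℝ) 1) {f : Space d → ℝ}
    (hf : AEStronglyMeasurable f (volume.restrict Ω)) :
    AEStronglyMeasurable (fun x => f (Φ s x)) (volume.restrict Ω) :=
  (hf.mono_ac (Measure.absolutelyContinuous_of_le_smul (h.map_le s hs))).comp_aemeasurable
    (h.aemeasurable s hs)

/-- The curves `s ↦ Φ s x` are compact in `Ω`, so they keep a positive distance to its
complement. -/
lemma exists_lt_infEDist (h : IsTransformHomotopy Ω c C φ ψ Φ) (hΩ : IsOpen Ω) {x : Space d}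
    (hx : x ∈ Ω) :
    ∃ δ > 0, ∀ s ∈ Icc (0 : ℝ) 1, ENNReal.ofReal δ ≤ Metric.infEDist (Φ s x) Ωᶜ := by
  have hK : IsCompact ((fun s => Φ s x) '' Icc (0 : ℝ) 1) :=
    isCompact_Icc.image_of_continuousOn (h.differentiable x hx).continuousOn
  obtain ⟨δ, hδ, hsub⟩ := hK.exists_thickening_subset_open hΩ
    (image_subset_iff.mpr fun s hs => h.mapsTo s hs hx)
  refine ⟨δ, hδ, fun s hs => Metric.le_infEDist.mpr fun z hz => ?_⟩
  by_contra! hlt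
  refine hz (hsub ?_)
  rw [Metric.mem_thickening_iff_exists_edist_lt]
  exact ⟨Φ s x, mem_image_of_mem _ hs, by rwa [edist_comm]⟩

/-- The case of finite speed: mollify `f`, integrate the gradient along the curves `s ↦ Φ s x`, and
pass to the limit by Fatou's lemma. No measurability in `(s, x)` jointly is needed because the
integrals over `s` are replaced by Riemann sums. -/
lemma lintegral_enorm_sub_le_of_speed (h : IsTransformHomotopy Ω c C φ ψ Φ) (hΩ : IsOpen Ω)
    {f : Space d → ℝ} (hf : IntegrableOn f Ω) {L : ℝ≥0}
    (hL : ∀ s ∈ Icc (0 : ℝ) 1, ∀ x ∈ Ω, ‖derivWithin (fun t => Φ t x) (Icc 0 1) s‖ₑ ≤ L) :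
    ∫⁻ x in Ω, ‖f (φ x) - f (ψ x)‖ₑ ≤ c * L * totalVariation Ω f := by
  have hΩm := hΩ.measurableSet
  -- The ratio of outer to inner radius is fixed, as the a.e. convergence of mollifications requires.
  let ρ : ℕ → ContDiffBump (0 : Space d) := fun j =>
    ⟨1 / ((j : ℝ) + 1), 2 * (1 / ((j : ℝ) + 1)), by positivity,
      lt_two_mul_self (by positivity)⟩
  have hρ0 : Tendsto (fun j => (ρ j).rOut) atTop (𝓝 0) := by
    have := (tendsto_one_div_add_atTop_nhds_zero_nat (𝕜 := ℝ)).const_mul 2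
    rwa [mul_zero] at this
  let g : ℕ → Space d → ℝ := fun j => mollify Ω (ρ j) f
  have hg (j : ℕ) : ContDiff ℝ 2 (g j) := contDiff_mollify hΩm hf (ρ j)
  let U : ℕ → Set (Space d) := fun j => {x | ENNReal.ofReal (ρ j).rOut < Metric.infEDist x Ωᶜ}
  have hU (j : ℕ) : IsOpen (U j) := isOpen_lt continuous_const Metric.continuous_infEDist
  let H : ℕ → Space d → ℝ≥0∞ := fun j => (U j).indicator fun x => ‖fderiv ℝ (g j) x‖ₑ
  have hH (j : ℕ) : Measurable (H j) :=
    ((hg j).continuous_fderiv two_ne_zero).enorm.measurable.indicator (hU j).measurableSet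
  have hHint (j : ℕ) : ∫⁻ x in Ω, H j x ≤ totalVariation Ω f := by
    refine (setLIntegral_le_lintegral _ _).trans ?_
    rw [lintegral_indicator (hU j).measurableSet]
    exact lintegral_enorm_fderiv_mollify_le hΩm hf (ρ j) le_rfl
  have htI (N : ℕ) : ∀ i ∈ Finset.range (N + 1), (i : ℝ) / ((N : ℝ) + 1) ∈ Icc (0 : ℝ) 1 := by
    intro i hi
    have hi' : (i : ℝ) ≤ N := by exact_mod_cast Nat.lt_succ_iff.mp (Finset.mem_range.mp hi)
    exact ⟨by positivity, (div_le_one (by positivity)).mpr (by linarith)⟩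
  let S : ℕ → ℕ → Space d → ℝ≥0∞ := fun j N x => (L : ℝ≥0∞) * (((N : ℝ≥0∞) + 1)⁻¹ *
    ∑ i ∈ Finset.range (N + 1), H j (Φ (i / ((N : ℝ) + 1)) x))
  have hHΦ (j N : ℕ) : ∀ i ∈ Finset.range (N + 1),
      AEMeasurable (fun x => H j (Φ (i / ((N : ℝ) + 1)) x)) (volume.restrict Ω) := fun i hi =>
    (hH j).comp_aemeasurable (h.aemeasurable _ (htI N i hi))
  have hSsum (j N : ℕ) : AEMeasurable
      (fun x => ∑ i ∈ Finset.range (N + 1), H j (Φ (i / ((N : ℝ) + 1)) x))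
      (volume.restrict Ω) := Finset.aemeasurable_fun_sum _ (hHΦ j N)
  have hSm (j N : ℕ) : AEMeasurable (S j N) (volume.restrict Ω) :=
    ((hSsum j N).const_mul _).const_mul _
  have hSint (j N : ℕ) : ∫⁻ x in Ω, S j N x ≤ c * L * totalVariation Ω f := by
    have hsum : ∫⁻ x in Ω, ∑ i ∈ Finset.range (N + 1), H j (Φ (i / ((N : ℝ) + 1)) x)
        ≤ ((N : ℝ≥0∞) + 1) * (c * totalVariation Ω f) := by
      rw [lintegral_finsetSum' _ (hHΦ j N)]
      refine (Finset.sum_le_card_nsmul _ _ (c * totalVariation Ω f) fun i hi => ?_).trans_eq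
        (by simp)
      exact (h.lintegral_comp_le (htI N i hi) (hH j)).trans (by gcongr; exact hHint j)
    simp only [S]
    rw [lintegral_const_mul'' _ ((hSsum j N).const_mul _), lintegral_const_mul'' _ (hSsum j N)]
    calc (L : ℝ≥0∞) * (((N : ℝ≥0∞) + 1)⁻¹ * _)
        ≤ L * (((N : ℝ≥0∞) + 1)⁻¹ * (((N : ℝ≥0∞) + 1) * (c * totalVariation Ω f))) := by
          gcongr
      _ = c * L * totalVariation Ω f := by
          rw [← mul_assoc (((N : ℝ≥0∞) + 1)⁻¹), ENNReal.inv_mul_cancel (by simp)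
            (by finiteness), one_mul]
          ring
  have hconv : ∀ᵐ x ∂volume.restrict Ω, Tendsto (fun j => g j x) atTop (𝓝 (Ω.indicator f x)) :=
    ae_restrict_of_ae (ContDiffBump.ae_convolution_tendsto_right_of_locallyIntegrable (K := 2) hρ0
      (Eventually.of_forall fun j => le_rfl) (hf.integrable_indicator hΩm).locallyIntegrable)
  have h01 : (0 : ℝ) ∈ Icc (0 : ℝ) 1 := by simp
  have h11 : (1 : ℝ) ∈ Icc (0 : ℝ) 1 := by simp
  have hpt : ∀ᵐ x ∂volume.restrict Ω, ‖f (φ x) - f (ψ x)‖ₑ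
      ≤ liminf (fun j => liminf (fun N => S j N x) atTop) atTop := by
    filter_upwards [h.ae_comp h01 hconv, h.ae_comp h11 hconv,
      ae_restrict_mem hΩm] with x hx0 hx1 hx
    rw [indicator_of_mem (h.mapsTo 0 h01 hx)] at hx0
    rw [indicator_of_mem (h.mapsTo 1 h11 hx)] at hx1
    rw [← h.zero x hx, ← h.one x hx, ← enorm_neg, neg_sub, ← (hx1.sub hx0).enorm.liminf_eq]
    obtain ⟨δ, hδ, hδU⟩ := h.exists_lt_infEDist hΩ hx
    refine liminf_le_liminf ?_
    filter_upwards [hρ0.eventually (gt_mem_nhds hδ)] with j hj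
    refine (enorm_sub_le_liminf_riemannSum ((hg j).of_le one_le_two) (h.differentiable x hx)
      (fun s hs => hL s hs x hx)).trans_eq ?_
    congr 1 with N
    simp only [S]
    congr 2
    refine Finset.sum_congr rfl fun i hi => ?_
    have : Φ (i / ((N : ℝ) + 1)) x ∈ U j :=
      ((ENNReal.ofReal_lt_ofReal_iff hδ).mpr hj).trans_le (hδU _ (htI N i hi))
    simp only [H, indicator_of_mem this]
  calc ∫⁻ x in Ω, ‖f (φ x) - f (ψ x)‖ₑ
      ≤ ∫⁻ x in Ω, liminf (fun j => liminf (fun N => S j N x) atTop) atTop := lintegral_mono_ae hpt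
    _ ≤ liminf (fun j => ∫⁻ x in Ω, liminf (fun N => S j N x) atTop) atTop :=
        lintegral_liminf_le' fun j => aemeasurable_liminf (hSm j)
    _ ≤ c * L * totalVariation Ω f := by
        refine liminf_le_of_frequently_le' (Frequently.of_forall fun j => ?_)
        exact (lintegral_liminf_le' (hSm j)).trans
          (liminf_le_of_frequently_le' (Frequently.of_forall (hSint j)))

/-- A function of bounded variation changes in `L₁` along a transform homotopy by at most its
variation times the distance of the end points. -/
lemma lintegral_enorm_sub_le (h : IsTransformHomotopy Ω c C φ ψ Φ) (hΩ : IsOpen Ω)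
    {f : Space d → ℝ} (hf : IntegrableOn f Ω) :
    ∫⁻ x in Ω, ‖f (φ x) - f (ψ x)‖ₑ
      ≤ c * C * bvNorm Ω f * eLpNorm (fun y => φ y - ψ y) ∞ (volume.restrict Ω) := by
  have h01 : (0 : ℝ) ∈ Icc (0 : ℝ) 1 := by simp
  have h11 : (1 : ℝ) ∈ Icc (0 : ℝ) 1 := by simp
  set δ := eLpNorm (fun y => φ y - ψ y) ∞ (volume.restrict Ω)
  by_cases hD : (C : ℝ≥0∞) * δ = ∞
  · -- The right-hand side is infinite unless `c` or the norm of `f` vanishes.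
    obtain ⟨hC, hδtop⟩ : (C : ℝ≥0∞) ≠ 0 ∧ δ = ∞ := by
      rcases ENNReal.mul_eq_top.mp hD with h' | h'
      · exact h'
      · exact absurd h'.1 ENNReal.coe_ne_top
    by_cases hc : c = 0
    · have hmap := h.map_le 0 h01
      rw [hc, ENNReal.coe_zero, zero_smul] at hmap
      have hz : volume.restrict Ω = 0 :=
        (Measure.map_eq_zero_iff (h.aemeasurable 0 h01)).mp (le_antisymm hmap (Measure.zero_le _))
      simp [hz]
    by_cases hb : bvNorm Ω f = 0
    · have hf0 : ∀ᵐ x ∂volume.restrict Ω, f x = 0 :=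
        (eLpNorm_eq_zero_iff hf.1 one_ne_zero).mp (add_eq_zero.mp hb).1
      have hae : ∀ᵐ x ∂volume.restrict Ω, ‖f (φ x) - f (ψ x)‖ₑ = 0 := by
        filter_upwards [h.ae_comp h01 hf0, h.ae_comp h11 hf0,
          ae_restrict_mem hΩ.measurableSet] with x hx0 hx1 hx
        rw [← h.zero x hx, ← h.one x hx, hx0, hx1]
        simp
      rw [lintegral_congr_ae hae]
      simp
    · rw [hδtop, ENNReal.mul_top]
      · exact le_top
      · exact mul_ne_zero (mul_ne_zero (by exact_mod_cast hc) hC) hb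
  · have hL := h.lintegral_enorm_sub_le_of_speed hΩ hf (L := ((C : ℝ≥0∞) * δ).toNNReal)
      (fun s hs x hx => by rw [ENNReal.coe_toNNReal hD]; exact h.speed_le s hs x hx)
    rw [ENNReal.coe_toNNReal hD] at hL
    calc _ ≤ _ := hL
      _ ≤ c * (C * δ) * bvNorm Ω f := by gcongr; exact le_add_self
      _ = _ := by ring

end IsTransformHomotopy

variable {k : ℕ}

/-! ### Polynomial interpolation -/

lemma eval_eq_sum_of_mem_polySpace {Pn : Finset (Param k)}
    {ℓ : Param k → MvPolynomial (Fin k) ℝ} (hℓ : IsLagrangeBasis Pn ℓ)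
    {p : MvPolynomial (Fin k) ℝ} (hp : p ∈ polySpace Pn ℓ) (μ : Param k) :
    MvPolynomial.eval μ p
      = ∑ η ∈ Pn, MvPolynomial.eval μ (ℓ η) * MvPolynomial.eval η p := by
  induction hp using Submodule.span_induction with
  | mem q hq =>
    obtain ⟨ν, hν, rfl⟩ := hq
    have hν' : ν ∈ Pn := hν
    rw [Finset.sum_congr rfl fun η hη => by rw [hℓ ν hν' η hη]]
    simp [hν']
  | zero => simp
  | add p q _ _ hp hq => simp only [map_add, mul_add, Finset.sum_add_distrib, ← hp, ← hq]
  | smul a p _ hp =>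
    simp only [MvPolynomial.smul_eval]
    rw [hp, Finset.mul_sum]
    exact Finset.sum_congr rfl fun η _ => by ring

/-- Interpolation is quasi-optimal, with the Lebesgue function at `μ` as stability constant. -/
lemma enorm_sub_interpolation_le {P : Set (Param k)} {Pn : Finset (Param k)}
    (hPn : (Pn : Set (Param k)) ⊆ P) {ℓ : Param k → MvPolynomial (Fin k) ℝ}
    (hℓ : IsLagrangeBasis Pn ℓ) (v : Param k → ℝ) {μ : Param k} (hμ : μ ∈ P) :
    ‖v μ - ∑ η ∈ Pn, MvPolynomial.eval μ (ℓ η) * v η‖ₑ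
      ≤ (1 + ∑ η ∈ Pn, ‖MvPolynomial.eval μ (ℓ η)‖ₑ) * bestApproxError P Pn ℓ v := by
  have htop : 1 + ∑ η ∈ Pn, ‖MvPolynomial.eval μ (ℓ η)‖ₑ ≠ ∞ :=
    ENNReal.add_ne_top.mpr ⟨ENNReal.one_ne_top, ENNReal.sum_ne_top.mpr fun _ _ => enorm_ne_top⟩
  rw [← ENNReal.div_le_iff' (by simp) htop]
  refine le_iInf₂ fun p hp => ENNReal.div_le_of_le_mul' ?_
  set e : ℝ≥0∞ := ⨆ η ∈ P, ‖v η - MvPolynomial.eval η p‖ₑ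
  have he : ∀ η ∈ P, ‖v η - MvPolynomial.eval η p‖ₑ ≤ e := fun η hη =>
    le_iSup₂ (f := fun η (_ : η ∈ P) => ‖v η - MvPolynomial.eval η p‖ₑ) η hη
  have hsplit : v μ - ∑ η ∈ Pn, MvPolynomial.eval μ (ℓ η) * v η
      = (v μ - MvPolynomial.eval μ p)
        - ∑ η ∈ Pn, MvPolynomial.eval μ (ℓ η) * (v η - MvPolynomial.eval η p) := by
    simp only [mul_sub, Finset.sum_sub_distrib, ← eval_eq_sum_of_mem_polySpace hℓ hp μ]
    ring
  rw [hsplit, add_mul, one_mul, Finset.sum_mul]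
  refine enorm_sub_le.trans (add_le_add (he μ hμ) ?_)
  refine (enorm_sum_le _ _).trans (Finset.sum_le_sum fun η hη => ?_)
  rw [enorm_mul]
  gcongr
  exact he η (hPn hη)

lemma sum_enorm_eval_le_lebesgueConst {P : Set (Param k)} (Pn : Finset (Param k))
    (ℓ : Param k → MvPolynomial (Fin k) ℝ) {μ : Param k} (hμ : μ ∈ P) :
    ∑ η ∈ Pn, ‖MvPolynomial.eval μ (ℓ η)‖ₑ ≤ lebesgueConst P Pn ℓ :=
  le_iSup₂ (f := fun μ (_ : μ ∈ P) => ∑ η ∈ Pn, ‖MvPolynomial.eval μ (ℓ η)‖ₑ) μ hμ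

end TransformedSnapshot

/-! ### The error of transformed snapshot interpolation -/

open TransformedSnapshot

theorem mainTheorem1 {d k : ℕ}
    (Ω : Set (TransformedSnapshot.Space d)) (hΩ : IsOpen Ω)
    (P : Set (TransformedSnapshot.Param k)) (Pn : Finset (TransformedSnapshot.Param k))
    (hPn : (Pn : Set (TransformedSnapshot.Param k)) ⊆ P)
    (ℓ : TransformedSnapshot.Param k → MvPolynomial (Fin k) ℝ)
    (hℓ : TransformedSnapshot.IsLagrangeBasis Pn ℓ)
    (u : TransformedSnapshot.Space d → TransformedSnapshot.Param k → ℝ)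
    (hu : ∀ μ ∈ P, TransformedSnapshot.IsBV Ω (fun x => u x μ))
    (φ φm : TransformedSnapshot.Param k → TransformedSnapshot.Param k →
      TransformedSnapshot.Space d → TransformedSnapshot.Space d)
    (hφ : ∀ μ ∈ P, ∀ η ∈ P, MapsTo (φ μ η) Ω Ω)
    (hφ_id : ∀ μ ∈ P, ∀ x ∈ Ω, φ μ μ x = x)
    (c C : ℝ≥0)
    (hΦ : ∀ μ ∈ P, ∀ η ∈ Pn, ∃ Φ : ℝ → TransformedSnapshot.Space d → TransformedSnapshot.Space d,
      TransformedSnapshot.IsTransformHomotopy Ω c C (φ μ η) (φm μ η) Φ)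
    (μ : TransformedSnapshot.Param k) (hμ : μ ∈ P) :
    eLpNorm (fun x => u x μ - TransformedSnapshot.transformedInterpolation Pn ℓ u φm x μ) 1
        (volume.restrict Ω)
      ≤ (1 + TransformedSnapshot.lebesgueConst P Pn ℓ) *
          (∫⁻ x in Ω, TransformedSnapshot.bestApproxError P Pn ℓ
            (TransformedSnapshot.transformedSnapshot u φ μ x))
        + (c : ℝ≥0∞) * (C : ℝ≥0∞) * TransformedSnapshot.lebesgueConst P Pn ℓ *
            (⨆ η ∈ Pn, TransformedSnapshot.bvNorm Ω (fun x => u x η)) *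
            (⨆ η ∈ Pn, eLpNorm (fun x => φ μ η x - φm μ η x) ∞ (volume.restrict Ω)) := by
  have hΩm := hΩ.measurableSet
  have h01 : (0 : ℝ) ∈ Icc (0 : ℝ) 1 := by simp
  have h11 : (1 : ℝ) ∈ Icc (0 : ℝ) 1 := by simp
  have hΛ := sum_enorm_eval_le_lebesgueConst Pn ℓ hμ
  set a : Param k → ℝ := fun η => MvPolynomial.eval μ (ℓ η)
  set B : ℝ≥0∞ := ⨆ η ∈ Pn, bvNorm Ω (fun x => u x η)
  set D : ℝ≥0∞ := ⨆ η ∈ Pn, eLpNorm (fun x => φ μ η x - φm μ η x) ∞ (volume.restrict Ω)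
  have hmeas : ∀ η ∈ Pn, AEMeasurable (fun x => ‖u (φ μ η x) η - u (φm μ η x) η‖ₑ)
      (volume.restrict Ω) := by
    intro η hη
    obtain ⟨Φ, h⟩ := hΦ μ hμ η hη
    have huη := (hu η (hPn hη)).integrableOn.aestronglyMeasurable
    refine (((h.aestronglyMeasurable_comp h01 huη).sub
      (h.aestronglyMeasurable_comp h11 huη)).congr ?_).enorm
    filter_upwards [ae_restrict_mem hΩm] with x hx
    simp only [Pi.sub_apply, h.zero x hx, h.one x hx]
  have hterm : ∀ η ∈ Pn, ∫⁻ x in Ω, ‖u (φ μ η x) η - u (φm μ η x) η‖ₑ ≤ c * C * B * D := by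
    intro η hη
    obtain ⟨Φ, h⟩ := hΦ μ hμ η hη
    refine (h.lintegral_enorm_sub_le hΩ (hu η (hPn hη)).integrableOn).trans ?_
    gcongr
    · exact le_iSup₂ (f := fun η (_ : η ∈ Pn) => bvNorm Ω (fun x => u x η)) η hη
    · exact le_iSup₂ (f := fun η (_ : η ∈ Pn) =>
        eLpNorm (fun x => φ μ η x - φm μ η x) ∞ (volume.restrict Ω)) η hη
  have hpt : ∀ x ∈ Ω, ‖u x μ - transformedInterpolation Pn ℓ u φm x μ‖ₑ
      ≤ (1 + ∑ η ∈ Pn, ‖a η‖ₑ) * bestApproxError P Pn ℓ (transformedSnapshot u φ μ x)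
        + ∑ η ∈ Pn, ‖a η‖ₑ * ‖u (φ μ η x) η - u (φm μ η x) η‖ₑ := by
    intro x hx
    have h1 := enorm_sub_interpolation_le hPn hℓ (transformedSnapshot u φ μ x) hμ
    have hsplit : u x μ - transformedInterpolation Pn ℓ u φm x μ
        = (transformedSnapshot u φ μ x μ - ∑ η ∈ Pn, a η * transformedSnapshot u φ μ x η)
          + ∑ η ∈ Pn, a η * (u (φ μ η x) η - u (φm μ η x) η) := by
      simp only [transformedInterpolation, transformedSnapshot, hφ_id μ hμ x hx, mul_sub,
        Finset.sum_sub_distrib, a]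
      ring
    rw [hsplit]
    refine (enorm_add_le _ _).trans (add_le_add h1 ((enorm_sum_le _ _).trans_eq ?_))
    simp only [enorm_mul]
  rw [eLpNorm_one_eq_lintegral_enorm]
  -- The best approximation error need not be measurable: the integral is split along the
  -- measurable summand, and the finite constant `1 + ∑ |ℓ_η(μ)|` is taken out before it is
  -- replaced by the possibly infinite Lebesgue constant.
  calc ∫⁻ x in Ω, ‖u x μ - transformedInterpolation Pn ℓ u φm x μ‖ₑ
      ≤ ∫⁻ x in Ω, ((1 + ∑ η ∈ Pn, ‖a η‖ₑ) *
          bestApproxError P Pn ℓ (transformedSnapshot u φ μ x)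
        + ∑ η ∈ Pn, ‖a η‖ₑ * ‖u (φ μ η x) η - u (φm μ η x) η‖ₑ) := setLIntegral_mono' hΩm hpt
    _ = (1 + ∑ η ∈ Pn, ‖a η‖ₑ) *
          (∫⁻ x in Ω, bestApproxError P Pn ℓ (transformedSnapshot u φ μ x))
        + ∑ η ∈ Pn, ‖a η‖ₑ * ∫⁻ x in Ω, ‖u (φ μ η x) η - u (φm μ η x) η‖ₑ := by
        rw [lintegral_add_right' _ (Finset.aemeasurable_fun_sum _ fun η hη =>
            (hmeas η hη).const_mul _),
          lintegral_const_mul' _ _ (ENNReal.add_ne_top.mpr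
            ⟨ENNReal.one_ne_top, ENNReal.sum_ne_top.mpr fun _ _ => enorm_ne_top⟩),
          lintegral_finsetSum' _ fun η hη => (hmeas η hη).const_mul _]
        congr 1
        exact Finset.sum_congr rfl fun η hη => lintegral_const_mul'' _ (hmeas η hη)
    _ ≤ (1 + lebesgueConst P Pn ℓ) *
          (∫⁻ x in Ω, bestApproxError P Pn ℓ (transformedSnapshot u φ μ x))
        + lebesgueConst P Pn ℓ * (c * C * B * D) := by
        gcongr
        refine (Finset.sum_le_sum fun η hη => mul_le_mul_right (hterm η hη) _).trans ?_
        rw [← Finset.sum_mul]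
        gcongr
    _ = _ := by ring
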